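/- Let $R$ be a commutative ring with identity. Say that an $R$-module $M$ has a finite projective resolution if for some integer $n\ge 0$ there is an exact sequence $0\to P_n\to P_{n-1}\to\cdots\to P_1\to P_0\to M\to 0$ of $R$-modules in which every $P_i$ is finitely generated and projective. Let the small finitistic dimension $\mathrm{fPD}(R)$ be the supremum of the projective dimensions of all $R$-modules that have a finite projective resolution, and let $\mathrm{id}_R R$ be the injective dimension of $R$ as a module over itself (both may be $\infty$; the zero module has projective and injective dimension $-\infty$). Then $$\mathrm{fPD}(R)\le \mathrm{id}_R R .$$ -/

import Mathlib

universe u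

/-- The `R`-module `M` has a finite projective resolution: for some `n` there is an exact sequence
`0 → P n → ⋯ → P 1 → P 0 → M → 0` of `R`-modules in which every `P i` is finitely generated
projective. The sequence is indexed by all of `ℕ`, with `P i = 0` for `i > n`; exactness at `P n`
then says that `P n → P (n - 1)` (or `P 0 → M` if `n = 0`) is injective. -/
def HasFiniteProjectiveResolution (R : Type u) [CommRing R]
    (M : Type u) [AddCommGroup M] [Module R M] : Prop :=
  ∃ (n : ℕ) (P : ℕ → ModuleCat.{u} R) (d : ∀ i, P (i + 1) →ₗ[R] P i) (ε : P 0 →ₗ[R] M),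
    (∀ i, Module.Finite R (P i) ∧ Module.Projective R (P i)) ∧
    (∀ i, n < i → Subsingleton (P i)) ∧
    Function.Surjective ε ∧
    Function.Exact (d 0) ε ∧
    ∀ i, Function.Exact (d (i + 1)) (d i)

/-- The small finitistic (projective) dimension `fPD(R)`: the supremum of the projective dimensions
of the `R`-modules that have a finite projective resolution. As for `projectiveDimension`, the value
`⊥` stands for the dimension of the zero module. Such modules are finitely generated, so up to
isomorphism all of them live in the universe of `R`. -/
noncomputable def smallFinitisticDimension (R : Type u) [CommRing R] : WithBot ℕ∞ :=
  ⨆ (M : ModuleCat.{u} R) (_ : HasFiniteProjectiveResolution R M),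
    CategoryTheory.projectiveDimension M

/-! Suppose `id R ≤ m`. The bound passes to finitely generated projectives, as retracts of `R^k`,
and then up a finite resolution to every `N` that has one. So `Ext^(m+1)(M, N) = 0` for all `M`, `N`
with such resolutions. Syzygies of `M` stay in this class, so dimension shifting reduces to `Ext^1`:
its vanishing on the first syzygy splits `P → M`, and `M` is projective. -/

open CategoryTheory Abelian

section Syzygy

variable {R : Type*} [CommRing R] {P₂ P₁ P₀ M : Type*}
  [AddCommGroup P₂] [AddCommGroup P₁] [AddCommGroup P₀] [AddCommGroup M]
  [Module R P₂] [Module R P₁] [Module R P₀] [Module R M]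
  {d₁ : P₂ →ₗ[R] P₁} {d₀ : P₁ →ₗ[R] P₀} {ε : P₀ →ₗ[R] M}

/-- The map `P₁ → ker ε` induced by `d₀` when `P₁ → P₀ → M` is exact. -/
def Function.Exact.toKer (h : Function.Exact d₀ ε) : P₁ →ₗ[R] LinearMap.ker ε :=
  d₀.codRestrict _ fun x => h.apply_apply_eq_zero x

lemma Function.Exact.toKer_surjective (h : Function.Exact d₀ ε) :
    Function.Surjective h.toKer := by
  rintro ⟨y, hy⟩
  obtain ⟨x, rfl⟩ := (h y).1 hy
  exact ⟨x, rfl⟩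

lemma Function.Exact.exact_toKer (h : Function.Exact d₀ ε) (h' : Function.Exact d₁ d₀) :
    Function.Exact d₁ h.toKer := fun x => by
  rw [← h' x, ← Submodule.coe_eq_zero]
  rfl

end Syzygy

section

variable {R : Type u} [CommRing R]

/-- If `M` has a finite projective resolution, then it is a quotient of a finitely generated
projective module by a submodule which again has a finite projective resolution. -/
lemma HasFiniteProjectiveResolution.exists_syzygy {M : ModuleCat.{u} R}
    (hM : HasFiniteProjectiveResolution R M) :
    ∃ (P : ModuleCat.{u} R) (ε : P →ₗ[R] M), Projective P ∧ Function.Surjective ε ∧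
      HasFiniteProjectiveResolution R (LinearMap.ker ε) := by
  obtain ⟨n, P, d, ε, hP, hn, hε, h₀, h⟩ := hM
  refine ⟨P 0, ε, (IsProjective.iff_projective _).1 (hP 0).2, hε, n, fun i => P (i + 1),
    fun i => d (i + 1), h₀.toKer, fun i => hP _, fun i hi => hn _ (by lia),
    h₀.toKer_surjective, h₀.exact_toKer (h 0), fun i => h (i + 1)⟩

variable (m : ℕ) [HasInjectiveDimensionLT (ModuleCat.of R R) m]

lemma hasInjectiveDimensionLT_fin_fun (k : ℕ) :
    HasInjectiveDimensionLT (ModuleCat.of R (Fin k → R)) m := by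
  induction k with
  | zero =>
    have := (ModuleCat.isZero_of_subsingleton
      (ModuleCat.of R (Fin 0 → R))).hasInjectiveDimensionLT_zero
    exact hasInjectiveDimensionLT_of_ge _ 0 m m.zero_le
  | succ k ih =>
    exact hasInjectiveDimensionLT_of_iso (X := ModuleCat.of R R ⊞ ModuleCat.of R (Fin k → R))
      (ModuleCat.biprodIsoProd _ _ ≪≫ (Fin.consLinearEquiv R fun _ => R).toModuleIso) m

/-- The injective dimension of a finitely generated projective module is bounded by that of the
ring. -/
lemma hasInjectiveDimensionLT_of_finite_projective (P : ModuleCat.{u} R) [Module.Finite R P]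
    [Module.Projective R P] : HasInjectiveDimensionLT P m := by
  obtain ⟨k, f, hf⟩ := Module.Finite.exists_fin' R P
  obtain ⟨g, hg⟩ := Module.projective_lifting_property f LinearMap.id hf
  have := hasInjectiveDimensionLT_fin_fun (R := R) m k
  exact Retract.hasInjectiveDimensionLT (Y := ModuleCat.of R (Fin k → R))
    ⟨ModuleCat.ofHom g, ModuleCat.ofHom f, ModuleCat.hom_ext hg⟩ m

/-- Here `n` counts the possibly nonzero terms, so the induction starts at `M = 0`. -/
lemma hasInjectiveDimensionLT_of_resolution (n : ℕ) (M : ModuleCat.{u} R)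
    (P : ℕ → ModuleCat.{u} R) (d : ∀ i, P (i + 1) →ₗ[R] P i) (ε : P 0 →ₗ[R] M)
    (hP : ∀ i, Module.Finite R (P i) ∧ Module.Projective R (P i))
    (hn : ∀ i, n ≤ i → Subsingleton (P i)) (hε : Function.Surjective ε)
    (h₀ : Function.Exact (d 0) ε) (h : ∀ i, Function.Exact (d (i + 1)) (d i)) :
    HasInjectiveDimensionLT M m := by
  induction n generalizing M P with
  | zero =>
    have := hn 0 le_rfl
    have : Subsingleton M := hε.subsingleton
    have := (ModuleCat.isZero_of_subsingleton M).hasInjectiveDimensionLT_zero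
    exact hasInjectiveDimensionLT_of_ge _ 0 m m.zero_le
  | succ n ih =>
    have hK := ih (ModuleCat.of R (LinearMap.ker ε)) (fun i => P (i + 1)) (fun i => d (i + 1))
      h₀.toKer (fun i => hP _) (fun i hi => hn _ (by lia)) h₀.toKer_surjective
      (h₀.exact_toKer (h 0)) (fun i => h (i + 1))
    obtain ⟨_, _⟩ := hP 0
    exact (LinearMap.shortExact_shortComplexKer hε).hasInjectiveDimensionLT_X₃ m
      (hasInjectiveDimensionLT_of_finite_projective m _)
      (hasInjectiveDimensionLT_of_ge (ModuleCat.of R (LinearMap.ker ε)) m (m + 1) (by lia))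

/-- The injective dimension of a module with a finite projective resolution is bounded by that of
the ring. -/
lemma HasFiniteProjectiveResolution.hasInjectiveDimensionLT {M : ModuleCat.{u} R}
    (hM : HasFiniteProjectiveResolution R M) : HasInjectiveDimensionLT M m := by
  obtain ⟨n, P, d, ε, hP, hn, hε, h₀, h⟩ := hM
  exact hasInjectiveDimensionLT_of_resolution m (n + 1) M P d ε hP (fun i hi => hn i hi) hε h₀ h

end

section

variable {R : Type u} [CommRing R]

/-- A module with a finite projective resolution whose `Ext` groups in degree `m + 1` into all such
modules vanish has projective dimension at most `m`. -/
lemma HasFiniteProjectiveResolution.hasProjectiveDimensionLE_of_ext (m : ℕ) {M : ModuleCat.{u} R}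
    (hM : HasFiniteProjectiveResolution R M)
    (h : ∀ N : ModuleCat.{u} R, HasFiniteProjectiveResolution R N →
      Subsingleton (Ext M N (m + 1))) :
    HasProjectiveDimensionLE M m := by
  induction m generalizing M with
  | zero =>
    obtain ⟨P, ε, hP, hε, hK⟩ := hM.exists_syzygy
    have hS := LinearMap.shortExact_shortComplexKer hε
    have := h (ModuleCat.of R (LinearMap.ker ε)) hK
    -- The obstruction to lifting `𝟙 M` along `ε` lies in `Ext^1(M, ker ε) = 0`.
    obtain ⟨s, hs⟩ := Ext.covariant_sequence_exact₃ M hS (Ext.mk₀ (𝟙 M)) (zero_add 1)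
      (Subsingleton.elim (α := Ext M (ModuleCat.of R (LinearMap.ker ε)) 1) _ _)
    obtain ⟨s, rfl⟩ := (Ext.mk₀_bijective M P).2 s
    rw [Ext.mk₀_comp_mk₀, (Ext.mk₀_bijective _ _).1.eq_iff] at hs
    rw [← projective_iff_hasProjectiveDimensionLE_zero]
    exact (Retract.mk s (ModuleCat.ofHom ε) hs).projective
  | succ m ih =>
    obtain ⟨P, ε, hP, hε, hK⟩ := hM.exists_syzygy
    have hS := LinearMap.shortExact_shortComplexKer hε
    refine (hS.hasProjectiveDimensionLT_X₃_iff m hP).2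
      (ih (M := ModuleCat.of R (LinearMap.ker ε)) hK fun N hN => subsingleton_of_forall_eq 0 ?_)
    intro x
    have := h N hN
    -- As `Ext^(m+2)(M, N) = 0`, the class `x` is restricted from `P`, where positive `Ext`
    -- vanishes.
    obtain ⟨y, rfl⟩ := Ext.contravariant_sequence_exact₁ hS N x (n₁ := m + 2) (by lia)
      (Subsingleton.elim (α := Ext M N (m + 2)) _ _)
    have hy : y = 0 := Ext.eq_zero_of_hasProjectiveDimensionLT (X := P) y 1 (by lia)
    rw [hy, Ext.comp_zero]

/-- The projective dimension of a module with a finite projective resolution is bounded by the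
injective dimension of the ring. -/
lemma HasFiniteProjectiveResolution.hasProjectiveDimensionLT {M : ModuleCat.{u} R}
    (hM : HasFiniteProjectiveResolution R M) (m : ℕ)
    [HasInjectiveDimensionLT (ModuleCat.of R R) m] : HasProjectiveDimensionLT M m := by
  cases m with
  | zero =>
    have := hM.hasInjectiveDimensionLT 0
    exact (isZero_of_hasInjectiveDimensionLT_zero M).hasProjectiveDimensionLT_zero
  | succ m =>
    refine hM.hasProjectiveDimensionLE_of_ext m fun N hN => ?_
    have := hN.hasInjectiveDimensionLT (m + 1)
    exact HasInjectiveDimensionLT.subsingleton N (m + 1) (m + 1) le_rfl M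

end

theorem corollary3p2 (R : Type u) [CommRing R] :
    smallFinitisticDimension R ≤
      CategoryTheory.injectiveDimension (ModuleCat.of R R) := by
  refine iSup₂_le fun M hM => ?_
  generalize h : injectiveDimension (ModuleCat.of R R) = b
  induction b with
  | bot =>
    have : HasInjectiveDimensionLT (ModuleCat.of R R) 0 :=
      ((injectiveDimension_eq_bot_iff _).1 h).hasInjectiveDimensionLT_zero
    have := hM.hasProjectiveDimensionLT 0
    exact ((projectiveDimension_eq_bot_iff M).2 (isZero_of_hasProjectiveDimensionLT_zero M)).le
  | coe b =>
    induction b with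
    | top => exact le_top
    | coe m =>
      have : HasInjectiveDimensionLE (ModuleCat.of R R) m := (injectiveDimension_le_iff _ m).1 h.le
      exact (projectiveDimension_le_iff M m).2 (hM.hasProjectiveDimensionLT (m + 1))
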